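/- Let $\mathcal{A}$ be a finite alphabet with at least two letters, totally ordered by $<$, and order finite words over $\mathcal{A}$ lexicographically. A Lyndon word is a nonempty primitive finite word that is the smallest word in its conjugacy class. For an infinite word $\mathbf{x}\in\mathcal{A}^{\mathbb{N}}$ let $F(\mathbf{x})$ be the set of its finite factors, and let $\mathcal{L}_{\mathbf{x}}(n)$ be the number of distinct Lyndon words of length at most $n$ in $F(\mathbf{x})$. The word $\mathbf{x}$ is recurrent if each of its factors occurs in it at least twice, ultimately periodic if $\mathbf{x}=vuuu\cdots$ for some finite words $v,u$ with $u$ nonempty, and aperiodic if it is not ultimately periodic. The shift orbit closure of $\mathbf{x}$ is the set of all $\mathbf{y}\in\mathcal{A}^{\mathbb{N}}$ with $F(\mathbf{y})\subseteq F(\mathbf{x})$. For distinct letters $a,b\in\mathcal{A}$ (in either order) let $f_1=b$, $f_2=a$ and $f_n=f_{n-1}f_{n-2}$ for $n\ge 3$; the unique infinite word that has every $f_n$ with $n\ge 2$ as a prefix is called a Fibonacci infinite word. Let $\mathbf{x}\in\mathcal{A}^{\mathbb{N}}$ be recurrent and let $\mathbf{f}\in\mathcal{A}^{\mathbb{N}}$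 be any Fibonacci infinite word. Then $\mathbf{x}$ is aperiodic if and only if $\mathcal{L}_{\mathbf{x}}(n)\ge\mathcal{L}_{\mathbf{f}}(n)$ for all $n$. Moreover, $\mathcal{L}_{\mathbf{x}}(n)=\mathcal{L}_{\mathbf{f}}(n)$ for all $n$ if and only if $\mathbf{x}$ is in the shift orbit closure of some Fibonacci infinite word $\mathbf{g}\in\mathcal{A}^{\mathbb{N}}$ (over some pair of distinct letters of $\mathcal{A}$, not necessarily the pair of $\mathbf{f}$). -/

import Mathlib

/-! Finite words over `A` are `List A` (ordered lexicographically by the Mathlib order on lists),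
infinite words over `A` are `ℕ → A`, indexed from `0`. -/

namespace LyndonFib

variable {A : Type*}

/-- The finite word `w` occurs in the infinite word `x` at position `i`. -/
def OccursAt (x : ℕ → A) (w : List A) (i : ℕ) : Prop :=
  ∀ (j : ℕ) (hj : j < w.length), w[j] = x (i + j)

/-- `w` is a prefix of the infinite word `x`. -/
def IsPrefixOf (w : List A) (x : ℕ → A) : Prop := OccursAt x w 0

/-- The set `F(x)` of factors of the infinite word `x`. -/
def factors (x : ℕ → A) : Set (List A) := {w | ∃ i, OccursAt x w i}

/-- Each factor of `x` occurs at least twice in `x`. -/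
def Recurrent (x : ℕ → A) : Prop :=
  ∀ w ∈ factors x, ∃ i j, i ≠ j ∧ OccursAt x w i ∧ OccursAt x w j

/-- `x = uuu⋯` for some nonempty finite word `u`. -/
def PurelyPeriodic (x : ℕ → A) : Prop :=
  ∃ u : List A, u ≠ [] ∧ ∀ n, u[n % u.length]? = some (x n)

/-- `x` has a purely periodic tail. -/
def UltimatelyPeriodic (x : ℕ → A) : Prop :=
  ∃ m, PurelyPeriodic (fun n => x (m + n))

def Aperiodic (x : ℕ → A) : Prop := ¬ UltimatelyPeriodic x

/-- The shift orbit closure of `x`: all infinite words `y` with `F(y) ⊆ F(x)`. -/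
def shiftOrbitClosure (x : ℕ → A) : Set (ℕ → A) := {y | factors y ⊆ factors x}

/-- `w` is not of the form `u ^ k` with `k ≥ 2` and `u` nonempty. -/
def Primitive (w : List A) : Prop :=
  ¬ ∃ (u : List A) (k : ℕ), u ≠ [] ∧ 2 ≤ k ∧ w = (List.replicate k u).flatten

/-- Lyndon words: nonempty primitive words that are lexicographically smallest
among their conjugates. -/
def IsLyndon [LinearOrder A] (w : List A) : Prop :=
  w ≠ [] ∧ Primitive w ∧ ∀ u v : List A, w = u ++ v → w ≤ v ++ u

/-- `L_x(n)`: the number of Lyndon factors of `x` of length at most `n`. -/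
noncomputable def lyndonCount [LinearOrder A] (x : ℕ → A) (n : ℕ) : ℕ :=
  {w : List A | w ∈ factors x ∧ IsLyndon w ∧ w.length ≤ n}.ncard

/-- The finite Fibonacci words `f₁ = b`, `f₂ = a`, `fₙ = fₙ₋₁ fₙ₋₂`, with the index
lowered by one: `fibWord a b n` is `fₙ₊₁`. -/
def fibWord (a b : A) : ℕ → List A
  | 0 => [b]
  | 1 => [a]
  | n + 2 => fibWord a b (n + 1) ++ fibWord a b n

/-- `f` is a Fibonacci infinite word: for some distinct letters `a`, `b`, every finite Fibonacci
word `fₙ` with `n ≥ 2` (built from `f₁ = b`, `f₂ = a`) is a prefix of `f`. As `a`, `b` range over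
ordered pairs of letters, both Fibonacci infinite words over each pair are covered. -/
def IsFibonacciWord (f : ℕ → A) : Prop :=
  ∃ a b : A, a ≠ b ∧ ∀ n, 1 ≤ n → IsPrefixOf (fibWord a b n) f

theorem le_length_fibWord (a b : A) : ∀ n, n ≤ (fibWord a b n).length ∧ 1 ≤ (fibWord a b n).length
  | 0 => by simp [fibWord]
  | 1 => by simp [fibWord]
  | n + 2 => by
    have h1 := le_length_fibWord a b (n + 1)
    have h0 := le_length_fibWord a b n
    simp only [fibWord, List.length_append]
    omega

theorem fibWord_prefix (a b : A) {m n : ℕ} (hm : 1 ≤ m) (hmn : m ≤ n) :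
    fibWord a b m <+: fibWord a b n := by
  induction n, hmn using Nat.le_induction with
  | base => exact List.prefix_rfl
  | succ n hn ih =>
    obtain ⟨k, rfl⟩ : ∃ k, n = k + 1 := ⟨n - 1, by omega⟩
    exact ih.trans (List.prefix_append _ _)

/-- For all letters `a`, `b` there is exactly one infinite word having every `fₙ`, `n ≥ 2`,
as a prefix. -/
theorem existsUnique_fibonacciWord (a b : A) :
    ∃! f : ℕ → A, ∀ n, 1 ≤ n → IsPrefixOf (fibWord a b n) f := by
  have hl : ∀ k, k < (fibWord a b (k + 1)).length := fun k =>
    (le_length_fibWord a b (k + 1)).1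
  refine ⟨fun k => (fibWord a b (k + 1))[k]'(hl k), ?_, ?_⟩
  · intro n hn j hj
    simp only [Nat.zero_add]
    rcases le_total n (j + 1) with h | h
    · exact (fibWord_prefix a b hn h).getElem hj
    · exact ((fibWord_prefix a b (by omega) h).getElem (hl j)).symm
  · intro g hg
    funext k
    have := hg (k + 1) (by omega) k (hl k)
    simpa using this.symm

end LyndonFib

/-!
Cutting an aperiodic word greedily into the longest Lyndon words of length at most `m + n` must
produce an increase `u < v` between neighbours, for a nonincreasing sequence over a finite set is
eventually constant. Then `u ++ v` is Lyndon, hence longer than `m + n` by the choice of `u`, so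
that one of `u`, `v` is longer than `n` or both are longer than `m`. With `L n` Lyndon factors of
length at most `n`, this gives `min (L m + 2) (L n + 1) ≤ L (m + n)`, and the number of Lyndon
factors grows at least as fast as the inverse of the Fibonacci sequence.

For a Fibonacci word this bound is attained: its Lyndon factors are the words of the sequence `[b]`,
`[a]`, … in which every term is the concatenation, in increasing order, of the two preceding ones.
Conversely, in an aperiodic word attaining the bound the letters are the first two terms, and if it
is an infinite product of two consecutive terms `u`, `v`, then the Lyndon word made of `u`, `u` and
`v` is excluded by its length (for two letters, by the choice of which one is `b`). So every block
`u` is isolated, and gluing it to the adjacent block `v` gives a product of the next two terms. At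
every scale a recurrent word of this kind locally looks like the Fibonacci word.
-/

namespace LyndonFib

variable {A : Type*}

section LexicographicOrder

variable [LinearOrder A]

theorem append_lt_append_of_not_prefix {u v : List A} (h : u < v) (hp : ¬ u <+: v)
    (y z : List A) : u ++ y < v ++ z := by
  induction h with
  | nil => exact absurd List.nil_prefix hp
  | rel hab => exact List.Lex.rel hab
  | cons _ ih => exact List.Lex.cons (ih fun h => hp (List.cons_prefix_cons.2 ⟨rfl, h⟩))

theorem le_of_isPrefix {u v : List A} (h : u <+: v) : u ≤ v :=
  not_lt.1 (List.IsPrefix.le h)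

theorem lt_append_of_ne_nil (u : List A) {v : List A} (hv : v ≠ []) : u < u ++ v :=
  (le_of_isPrefix (List.prefix_append u v)).lt_of_ne (by simpa using hv.symm)

end LexicographicOrder

section CommutingWords

theorem exists_eq_flatten_replicate_of_append_comm {u v : List A} (h : u ++ v = v ++ u) :
    ∃ (t : List A) (i j : ℕ),
      u = (List.replicate i t).flatten ∧ v = (List.replicate j t).flatten := by
  induction hn : u.length + v.length using Nat.strong_induction_on generalizing u v with
  | _ n ih =>
    wlog hle : u.length ≤ v.length generalizing u v
    · obtain ⟨t, i, j, hv, hu⟩ := this h.symm (by omega) (by omega)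
      exact ⟨t, j, i, hu, hv⟩
    rcases eq_or_ne u [] with rfl | hu
    · exact ⟨v, 0, 1, by simp, by simp⟩
    obtain ⟨w, rfl⟩ : u <+: v :=
      List.prefix_of_prefix_length_le (List.prefix_append u v) (h ▸ List.prefix_append v u) hle
    rw [List.append_assoc, List.append_cancel_left_eq] at h
    have hlt : u.length + w.length < n := by
      have := List.length_pos_of_ne_nil hu
      rw [List.length_append] at hn
      omega
    obtain ⟨t, i, j, hi, hj⟩ := ih _ hlt h rfl
    exact ⟨t, i, i + j, hi, by rw [List.replicate_add, List.flatten_append, ← hi, ← hj]⟩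

theorem Primitive.append_ne_append {u v : List A} (h : Primitive (u ++ v)) (hu : u ≠ [])
    (hv : v ≠ []) : u ++ v ≠ v ++ u := by
  intro hcomm
  obtain ⟨t, i, j, rfl, rfl⟩ := exists_eq_flatten_replicate_of_append_comm hcomm
  have hi : i ≠ 0 := by rintro rfl; simp at hu
  have hj : j ≠ 0 := by rintro rfl; simp at hv
  refine h ⟨t, i + j, ?_, by omega, by rw [List.replicate_add, List.flatten_append]⟩
  rintro rfl
  simp at hu

end CommutingWords

section LyndonWords

variable [LinearOrder A]

theorem IsLyndon.lt_suffix {u v : List A} (h : IsLyndon (u ++ v)) (hu : u ≠ []) (hv : v ≠ []) :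
    u ++ v < v := by
  obtain ⟨-, hprim, hmin⟩ := h
  by_contra hle
  have hlt : v < u ++ v := (not_lt.1 hle).lt_of_ne (by simpa using hu.symm)
  by_cases hpre : v <+: u ++ v
  · obtain ⟨z, hz⟩ := hpre
    have hlen : z.length = u.length := by
      have := congrArg List.length hz
      simp only [List.length_append] at this
      omega
    have hzu : ¬ u < z := fun hlt =>
      (List.append_left_lt hlt).not_ge (hz ▸ hmin u v rfl)
    have huz : ¬ z < u := fun hlt =>
      (append_lt_append_of_not_prefix hlt (fun h => hlt.ne (h.eq_of_length hlen)) v v).not_ge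
        (hmin v z hz.symm)
    obtain rfl : z = u := le_antisymm (not_lt.1 hzu) (not_lt.1 huz)
    exact hprim.append_ne_append hu hv hz.symm
  · refine (hmin u v rfl).not_gt ?_
    simpa using append_lt_append_of_not_prefix hlt hpre u []

theorem primitive_of_lt_suffix {w : List A}
    (h : ∀ u v, w = u ++ v → u ≠ [] → v ≠ [] → w < v) : Primitive w := by
  rintro ⟨u, k, hu, hk, rfl⟩
  obtain ⟨k, rfl⟩ := Nat.exists_eq_add_of_le' (show 1 ≤ k by omega)
  have hk' : (List.replicate k u).flatten ≠ [] := by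
    simpa [List.flatten_eq_nil_iff, hu] using (by omega : k ≠ 0)
  refine (h (List.replicate k u).flatten u ?_ hk' hu).not_ge ?_
  · simp [List.replicate_add]
  · rw [List.replicate_succ, List.flatten_cons]
    exact le_of_isPrefix (List.prefix_append _ _)

theorem isLyndon_of_lt_suffix {w : List A} (hw : w ≠ [])
    (h : ∀ u v, w = u ++ v → u ≠ [] → v ≠ [] → w < v) : IsLyndon w := by
  refine ⟨hw, primitive_of_lt_suffix h, ?_⟩
  rintro u v rfl
  rcases eq_or_ne u [] with rfl | hu
  · simp
  rcases eq_or_ne v [] with rfl | hv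
  · simp
  exact (h u v rfl hu hv).le.trans (le_of_isPrefix (List.prefix_append v u))

theorem isLyndon_singleton (c : A) : IsLyndon [c] := by
  refine isLyndon_of_lt_suffix (by simp) fun u v h hu hv => absurd h fun h => ?_
  rcases List.append_eq_singleton_iff.1 h.symm with ⟨rfl, -⟩ | ⟨-, rfl⟩
  · exact hu rfl
  · exact hv rfl

theorem IsLyndon.append_lt_right {u v : List A} (hv : IsLyndon v) (hu : u ≠ []) (h : u < v) :
    u ++ v < v := by
  by_cases hp : u <+: v
  · obtain ⟨z, rfl⟩ := hp
    have hz : z ≠ [] := by rintro rfl; simp at h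
    exact List.append_left_lt (hv.lt_suffix hu hz)
  · simpa using append_lt_append_of_not_prefix h hp v []

theorem IsLyndon.append {u v : List A} (hu : IsLyndon u) (hv : IsLyndon v) (h : u < v) :
    IsLyndon (u ++ v) := by
  have huv := hv.append_lt_right hu.1 h
  refine isLyndon_of_lt_suffix (by simp [hu.1]) fun p q heq hp hq => ?_
  rcases List.append_eq_append_iff.1 heq with ⟨y, -, rfl⟩ | ⟨y, rfl, rfl⟩
  · rcases eq_or_ne y [] with rfl | hy
    · exact huv
    · exact huv.trans (hv.lt_suffix hy hq)
  · rcases eq_or_ne y [] with rfl | hy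
    · simpa using huv
    · refine append_lt_append_of_not_prefix (hu.lt_suffix hp hy) (fun hpre => ?_) v v
      have := hpre.length_le
      have := List.length_pos_of_ne_nil hp
      simp only [List.length_append] at *
      omega

theorem IsLyndon.not_prefix {u v : List A} (h : IsLyndon (u ++ v)) (hu : u ≠ []) (hv : v ≠ []) :
    ¬ v <+: u ++ v :=
  fun hp => (h.lt_suffix hu hv).not_ge (le_of_isPrefix hp)

theorem IsLyndon.left_lt_right {u v w : List A} (h : IsLyndon (u ++ v ++ w)) (hu : u ≠ [])
    (hw : w ≠ []) : u < w := by
  refine lt_of_le_of_lt (le_of_isPrefix ?_) (h.lt_suffix (by simp [hu]) hw)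
  simp [List.append_assoc]

/-- The concatenation of two words in increasing order: for distinct Lyndon words, the order that
yields a Lyndon word. -/
def sortedAppend (u v : List A) : List A := min u v ++ max u v

theorem sortedAppend_of_lt {u v : List A} (h : u < v) : sortedAppend u v = u ++ v := by
  rw [sortedAppend, min_eq_left h.le, max_eq_right h.le]

theorem sortedAppend_of_gt {u v : List A} (h : v < u) : sortedAppend u v = v ++ u := by
  rw [sortedAppend, min_eq_right h.le, max_eq_left h.le]

theorem length_sortedAppend (u v : List A) :
    (sortedAppend u v).length = u.length + v.length := by
  rcases lt_trichotomy u v with h | rfl | h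
  · simp [sortedAppend_of_lt h]
  · simp [sortedAppend]
  · simp [sortedAppend_of_gt h, Nat.add_comm]

theorem isLyndon_sortedAppend {u v : List A} (hu : IsLyndon u) (hv : IsLyndon v) (h : u ≠ v) :
    IsLyndon (sortedAppend u v) := by
  rcases h.lt_or_gt with h | h
  · exact sortedAppend_of_lt h ▸ hu.append hv h
  · exact sortedAppend_of_gt h ▸ hv.append hu h

end LyndonWords

section Occurrences

variable {x : ℕ → A}

theorem occursAt_append {u v : List A} {i : ℕ} :
    OccursAt x (u ++ v) i ↔ OccursAt x u i ∧ OccursAt x v (i + u.length) := by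
  constructor
  · refine fun h => ⟨fun j hj => ?_, fun j hj => ?_⟩
    · rw [← h j (by simp; omega), List.getElem_append_left hj]
    · have := h (u.length + j) (by simpa using hj)
      rwa [List.getElem_append_right (by omega), ← Nat.add_assoc,
        getElem_congr_idx (Nat.add_sub_cancel_left u.length j)] at this
  · rintro ⟨hu, hv⟩ j hj
    rcases lt_or_ge j u.length with h | h
    · rw [List.getElem_append_left h, hu j h]
    · rw [List.getElem_append_right h, hv (j - u.length) (by simp at hj; omega),
        Nat.add_assoc, Nat.add_sub_cancel' h]

theorem occursAt_singleton {c : A} {i : ℕ} : OccursAt x [c] i ↔ c = x i := by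
  simp [OccursAt]

theorem occursAt_map_range' (x : ℕ → A) (i n : ℕ) : OccursAt x ((List.range' i n).map x) i :=
  fun j hj => by simp

theorem OccursAt.isPrefix {u v : List A} {i : ℕ} (hu : OccursAt x u i) (hv : OccursAt x v i)
    (hle : u.length ≤ v.length) : u <+: v :=
  List.prefix_iff_getElem.2 ⟨hle, fun j hj => by rw [hu j hj, hv j]⟩

theorem OccursAt.isInfix {u v : List A} {i k : ℕ} (hu : OccursAt x u k) (hv : OccursAt x v i)
    (hik : i ≤ k) (hk : k + u.length ≤ i + v.length) : u <:+: v := by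
  have hlen : i + (v.take (k - i)).length = k := by
    rw [List.length_take]
    omega
  rw [← List.take_append_drop (k - i) v, occursAt_append, hlen] at hv
  exact (hu.isPrefix hv.2 (by simp; omega)).isInfix.trans (List.drop_suffix _ _).isInfix

theorem mem_factors_of_isInfix {u v : List A} (h : u <:+: v) (hv : v ∈ factors x) :
    u ∈ factors x := by
  obtain ⟨p, q, rfl⟩ := h
  obtain ⟨i, hi⟩ := hv
  exact ⟨_, (occursAt_append.1 (occursAt_append.1 hi).1).2⟩

theorem exists_append_mem_factors {w : List A} (hw : w ∈ factors x) :
    ∃ c, w ++ [c] ∈ factors x := by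
  obtain ⟨i, hi⟩ := hw
  exact ⟨_, i, occursAt_append.2 ⟨hi, occursAt_singleton.2 rfl⟩⟩

theorem Recurrent.exists_occursAt_ge (hx : Recurrent x) {w : List A} (hw : w ∈ factors x)
    (m : ℕ) : ∃ i, m ≤ i ∧ OccursAt x w i := by
  induction m with
  | zero => exact hw.imp fun i hi => ⟨i.zero_le, hi⟩
  | succ m ih =>
    obtain ⟨i, hmi, hi⟩ := ih
    set p := (List.range' 0 i).map x
    have hp : p.length = i := by simp [p]
    have hpw : OccursAt x (p ++ w) 0 :=
      occursAt_append.2 ⟨occursAt_map_range' x 0 i, by rwa [hp, Nat.zero_add]⟩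
    obtain ⟨k, hk, hpk⟩ : ∃ k, 0 < k ∧ OccursAt x (p ++ w) k := by
      obtain ⟨k, l, hkl, hk, hl⟩ := hx _ ⟨0, hpw⟩
      rcases Nat.eq_zero_or_pos k with rfl | hpos
      · exact ⟨l, by omega, hl⟩
      · exact ⟨k, hpos, hk⟩
    exact ⟨k + p.length, by omega, (occursAt_append.1 hpk).2⟩

theorem ultimatelyPeriodic_of_occursAt {u : List A} (hu : u ≠ []) {J : Set ℕ} (hJ : J.Nonempty)
    (h : ∀ i ∈ J, OccursAt x u i ∧ i + u.length ∈ J) : UltimatelyPeriodic x := by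
  obtain ⟨m, hm⟩ := hJ
  have hmem : ∀ k, m + k * u.length ∈ J := fun k => by
    induction k with
    | zero => simpa using hm
    | succ k ih => simpa [add_mul, add_assoc] using (h _ ih).2
  refine ⟨m, u, hu, fun n => ?_⟩
  have hlt : n % u.length < u.length := Nat.mod_lt _ (List.length_pos_of_ne_nil hu)
  rw [List.getElem?_eq_getElem hlt, (h _ (hmem (n / u.length))).1 _ hlt, Nat.add_assoc,
    Nat.div_add_mod']

end Occurrences

section LyndonFactors

variable [LinearOrder A] {x : ℕ → A}

/-- The Lyndon words counted by `lyndonCount x n`. -/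
def lyndonFactors (x : ℕ → A) (n : ℕ) : Set (List A) :=
  {w | w ∈ factors x ∧ IsLyndon w ∧ w.length ≤ n}

theorem ncard_lyndonFactors (x : ℕ → A) (n : ℕ) : (lyndonFactors x n).ncard = lyndonCount x n :=
  rfl

theorem lyndonFactors_mono (x : ℕ → A) : Monotone (lyndonFactors x) :=
  fun _ _ hmn _ hw => ⟨hw.1, hw.2.1, hw.2.2.trans hmn⟩

theorem finite_lyndonFactors [Finite A] (x : ℕ → A) (n : ℕ) : (lyndonFactors x n).Finite :=
  (List.finite_length_le A n).subset fun _ hw => hw.2.2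

theorem lyndonCount_mono [Finite A] (x : ℕ → A) : Monotone (lyndonCount x) :=
  fun _ n hmn => Set.ncard_le_ncard (lyndonFactors_mono x hmn) (finite_lyndonFactors x n)

end LyndonFactors

section LowerBound

variable [LinearOrder A] [Finite A] {x : ℕ → A}

theorem exists_longest_lyndon_occursAt (x : ℕ → A) {N : ℕ} (hN : 1 ≤ N) (i : ℕ) :
    ∃ w ∈ lyndonFactors x N, OccursAt x w i ∧
      ∀ w' ∈ lyndonFactors x N, OccursAt x w' i → w'.length ≤ w.length := by
  have hletter : OccursAt x [x i] i := occursAt_singleton.2 rfl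
  obtain ⟨w, ⟨hw, hwi⟩, hmax⟩ := Set.exists_max_image
    {w | w ∈ lyndonFactors x N ∧ OccursAt x w i} List.length
    ((finite_lyndonFactors x N).subset fun w h => h.1)
    ⟨[x i], ⟨⟨i, hletter⟩, isLyndon_singleton _, by simpa⟩, hletter⟩
  exact ⟨w, hw, hwi, fun w' hw' hi => hmax w' ⟨hw', hi⟩⟩

/-- Otherwise, cutting `x` greedily into Lyndon words of length at most `N` yields nonincreasing
blocks, which are eventually constant because there are finitely many of them. -/
theorem Aperiodic.exists_lyndonFactors_append (hx : Aperiodic x) {N : ℕ} (hN : 1 ≤ N) :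
    ∃ u ∈ lyndonFactors x N, ∃ v ∈ lyndonFactors x N,
      u < v ∧ u ++ v ∈ factors x ∧ N < (u ++ v).length := by
  by_contra! hcon
  choose t ht hocc hmax using exists_longest_lyndon_occursAt x hN
  have hnonincr : ∀ i, t (i + (t i).length) ≤ t i := fun i => by
    by_contra! hlt
    have happ : OccursAt x (t i ++ t (i + (t i).length)) i :=
      occursAt_append.2 ⟨hocc _, hocc _⟩
    have hle := hmax i _ ⟨⟨i, happ⟩, (ht _).2.1.append (ht _).2.1 hlt,
      hcon _ (ht _) _ (ht _) hlt ⟨i, happ⟩⟩ happ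
    have := List.length_pos_of_ne_nil (ht (i + (t i).length)).2.1.1
    rw [List.length_append] at hle
    omega
  have hfin : (Set.range t).Finite :=
    (finite_lyndonFactors x N).subset (Set.range_subset_iff.2 ht)
  obtain ⟨-, ⟨k, rfl⟩, hmin⟩ := Set.exists_min_image (Set.range t) id hfin ⟨_, 0, rfl⟩
  refine hx (ultimatelyPeriodic_of_occursAt (ht k).2.1.1 (J := {i | t i = t k}) ⟨k, rfl⟩ ?_)
  intro i (hi : t i = t k)
  rw [← hi]
  exact ⟨hocc i, le_antisymm (hnonincr i) (hi ▸ hmin _ ⟨_, rfl⟩)⟩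

theorem Aperiodic.min_le_lyndonCount_add (hx : Aperiodic x) {m n : ℕ} (hmn : 1 ≤ m + n) :
    min (lyndonCount x m + 2) (lyndonCount x n + 1) ≤ lyndonCount x (m + n) := by
  obtain ⟨u, hu, v, hv, hlt, -, hlen⟩ := hx.exists_lyndonFactors_append hmn
  rw [List.length_append] at hlen
  by_contra! hcon
  obtain ⟨hm, hn⟩ := lt_min_iff.1 hcon
  have heq : lyndonFactors x n = lyndonFactors x (m + n) :=
    Set.eq_of_subset_of_ncard_le (lyndonFactors_mono x (Nat.le_add_left n m))
      (Nat.lt_succ_iff.1 hn) (finite_lyndonFactors x _)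
  have hun : u.length ≤ n := (heq ▸ hu).2.2
  have hvn : v.length ≤ n := (heq ▸ hv).2.2
  have hum : u ∉ insert v (lyndonFactors x m) := by
    rintro (h | h)
    · exact hlt.ne h
    · have := h.2.2
      omega
  have hvm : v ∉ lyndonFactors x m := fun h => by
    have := h.2.2
    omega
  have hsub : insert u (insert v (lyndonFactors x m)) ⊆ lyndonFactors x (m + n) :=
    Set.insert_subset hu (Set.insert_subset hv (lyndonFactors_mono x (Nat.le_add_right m n)))
  have hcard := Set.ncard_le_ncard hsub (finite_lyndonFactors x _)
  rw [Set.ncard_insert_of_notMem hum ((finite_lyndonFactors x m).insert v),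
    Set.ncard_insert_of_notMem hvm (finite_lyndonFactors x m), ncard_lyndonFactors,
    ncard_lyndonFactors] at hcard
  omega

theorem Aperiodic.le_lyndonCount_fib (hx : Aperiodic x) (k : ℕ) :
    k ≤ lyndonCount x (Nat.fib k) := by
  induction k using Nat.twoStepInduction with
  | zero => exact Nat.zero_le _
  | one =>
    have := hx.min_le_lyndonCount_add (m := 0) (n := 1) le_rfl
    rw [Nat.zero_add] at this
    rw [Nat.fib_one]
    omega
  | more k h₀ h₁ =>
    have hpos : 0 < Nat.fib (k + 2) := Nat.fib_pos.2 (by omega)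
    rw [Nat.fib_add_two] at hpos ⊢
    have := hx.min_le_lyndonCount_add hpos
    omega

theorem Aperiodic.greatestFib_le_lyndonCount (hx : Aperiodic x) (n : ℕ) :
    Nat.greatestFib n ≤ lyndonCount x n :=
  (hx.le_lyndonCount_fib _).trans (lyndonCount_mono x (Nat.fib_greatestFib_le n))

end LowerBound

section Periodic

variable [LinearOrder A] {x : ℕ → A}

theorem IsLyndon.length_le_of_period {w : List A} (hw : IsLyndon w) {p m i : ℕ} (hp : 0 < p)
    (hx : ∀ n, m ≤ n → x (n + p) = x n) (hi : OccursAt x w i) (hmi : m ≤ i) : w.length ≤ p := by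
  by_contra! hlt
  obtain ⟨u, v, rfl, hu⟩ : ∃ u v, w = u ++ v ∧ u.length = p :=
    ⟨w.take p, w.drop p, (List.take_append_drop p w).symm, List.length_take_of_le hlt.le⟩
  have hborder : v <+: u ++ v := by
    refine OccursAt.isPrefix (i := i) (fun j hj => ?_) hi (by simp)
    rw [(occursAt_append.1 hi).2 j hj, hu, Nat.add_right_comm, hx _ (by omega)]
  refine hw.not_prefix (List.ne_nil_of_length_pos (hu ▸ hp)) ?_ hborder
  rintro rfl
  simp [hu] at hlt

theorem Recurrent.exists_length_le_of_ultimatelyPeriodic (hx : Recurrent x)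
    (hper : UltimatelyPeriodic x) : ∃ p, ∀ w ∈ factors x, IsLyndon w → w.length ≤ p := by
  obtain ⟨m, u, hu, h⟩ := hper
  refine ⟨u.length, fun w hw hlyn => ?_⟩
  obtain ⟨i, hmi, hi⟩ := hx.exists_occursAt_ge hw m
  refine hlyn.length_le_of_period (List.length_pos_of_ne_nil hu) (fun n hn => ?_) hi hmi
  obtain ⟨k, rfl⟩ := Nat.exists_eq_add_of_le hn
  rw [Nat.add_assoc, ← Option.some_inj]
  exact (h (k + u.length)).symm.trans (by rw [Nat.add_mod_right, h k])

theorem Recurrent.aperiodic_of_greatestFib_le_lyndonCount [Finite A] (hx : Recurrent x)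
    (h : ∀ n, Nat.greatestFib n ≤ lyndonCount x n) : Aperiodic x := by
  intro hper
  obtain ⟨p, hp⟩ := hx.exists_length_le_of_ultimatelyPeriodic hper
  have hbound : ∀ n, lyndonCount x n ≤ lyndonCount x p := fun n =>
    Set.ncard_le_ncard (fun w hw => ⟨hw.1, hw.2.1, hp w hw.1 hw.2.1⟩) (finite_lyndonFactors x p)
  have := Nat.le_greatestFib.2 (le_refl (Nat.fib (lyndonCount x p + 1)))
  have := (h (Nat.fib (lyndonCount x p + 1))).trans (hbound _)
  omega

end Periodic

section BlockSubstitution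

/-- The image of a letter of the coding alphabet `Bool`: `false` codes the block `u` and `true`
the block `v`. -/
def block (u v : List A) (e : Bool) : List A := bif e then v else u

/-- The word obtained from `c` by the substitution `false ↦ u`, `true ↦ v`. -/
def blockSubst (u v : List A) (c : List Bool) : List A := c.flatMap (block u v)

theorem block_ne_nil {u v : List A} (hu : u ≠ []) (hv : v ≠ []) : ∀ e, block u v e ≠ []
  | false => hu
  | true => hv

theorem blockSubst_append (u v : List A) (c d : List Bool) :
    blockSubst u v (c ++ d) = blockSubst u v c ++ blockSubst u v d :=
  List.flatMap_append

theorem blockSubst_singleton (u v : List A) (e : Bool) : blockSubst u v [e] = block u v e :=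
  List.flatMap_singleton _ _

theorem blockSubst_cons (u v : List A) (e : Bool) (c : List Bool) :
    blockSubst u v (e :: c) = block u v e ++ blockSubst u v c :=
  List.flatMap_cons

theorem blockSubst_pair (u v : List A) (e e' : Bool) :
    blockSubst u v [e, e'] = block u v e ++ block u v e' := by
  rw [blockSubst_cons, blockSubst_singleton]

theorem blockSubst_isInfix (u v : List A) {c d : List Bool} (h : c <:+: d) :
    blockSubst u v c <:+: blockSubst u v d :=
  h.flatMap _

theorem blockSubst_blockSubst (u v : List A) (p q c : List Bool) :
    blockSubst u v (blockSubst p q c) =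
      blockSubst (blockSubst u v p) (blockSubst u v q) c := by
  rw [blockSubst, blockSubst, List.flatMap_assoc, blockSubst]
  congr 1
  funext e
  cases e <;> rfl

theorem exists_eq_blockSubst_singleton {a b : A} {w : List A} {d : List Bool}
    (h : w <:+: blockSubst [b] [a] d) : ∃ c, c <:+: d ∧ w = blockSubst [b] [a] c := by
  have hmap : ∀ c, blockSubst [b] [a] c = c.map fun e => bif e then a else b := fun c => by
    rw [blockSubst, ← List.flatMap_pure_eq_map]
    congr 1
    funext e
    cases e <;> rfl
  simp only [hmap] at h ⊢
  exact List.infix_map_iff.1 h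

end BlockSubstitution

section FibonacciMorphism

/-- The Fibonacci morphism `true ↦ true false`, `false ↦ true` on the coding alphabet. -/
def fibMorph : List Bool → List Bool := blockSubst [true] [true, false]

/-- The conjugate `true ↦ false true`, `false ↦ true` of the Fibonacci morphism. -/
def fibMorphConj : List Bool → List Bool := blockSubst [true] [false, true]

theorem fibMorph_append (c d : List Bool) : fibMorph (c ++ d) = fibMorph c ++ fibMorph d :=
  blockSubst_append _ _ c d

theorem fibMorph_false_cons (c : List Bool) : fibMorph (false :: c) = true :: fibMorph c := rfl

theorem fibMorph_true_cons (c : List Bool) : fibMorph (true :: c) = true :: false :: fibMorph c :=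
  rfl

theorem true_cons_fibMorphConj (c : List Bool) :
    true :: fibMorphConj c = fibMorph c ++ [true] := by
  induction c with
  | nil => rfl
  | cons e c ih =>
    rw [fibMorphConj] at ih ⊢
    cases e
    · simp [blockSubst_cons, block, ih, fibMorph_false_cons]
    · simp [blockSubst_cons, block, ih, fibMorph_true_cons]

theorem fibMorphConj_eq_reverse (c : List Bool) :
    fibMorphConj c = (fibMorph c.reverse).reverse := by
  rw [fibMorph, blockSubst, List.reverse_flatMap, List.reverse_reverse, fibMorphConj, blockSubst]
  congr 1
  funext e
  cases e <;> rfl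

theorem fibMorph_eq_append_true_cons {d p q : List Bool} (h : fibMorph d = p ++ true :: q) :
    ∃ d₁ d₂, d = d₁ ++ d₂ ∧ fibMorph d₁ = p ∧ fibMorph d₂ = true :: q := by
  induction d generalizing p with
  | nil => simp [fibMorph, blockSubst] at h
  | cons e d ih =>
    rcases p with _ | ⟨f, p⟩
    · exact ⟨[], e :: d, rfl, rfl, h⟩
    cases e
    · obtain ⟨rfl, htail⟩ : true = f ∧ fibMorph d = p ++ true :: q := by
        simpa [fibMorph_false_cons] using h
      obtain ⟨d₁, d₂, rfl, rfl, h₂⟩ := ih htail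
      exact ⟨false :: d₁, d₂, rfl, rfl, h₂⟩
    · rcases p with _ | ⟨f', p⟩
      · simp [fibMorph_true_cons] at h
      obtain ⟨rfl, rfl, htail⟩ : true = f ∧ false = f' ∧ fibMorph d = p ++ true :: q := by
        simpa [fibMorph_true_cons] using h
      obtain ⟨d₁, d₂, rfl, rfl, h₂⟩ := ih htail
      exact ⟨true :: d₁, d₂, rfl, rfl, h₂⟩

theorem fibMorph_eq_append_false_cons {d p q : List Bool} (h : fibMorph d = p ++ false :: q) :
    ∃ d₁ d₂, d = d₁ ++ d₂ ∧ fibMorph d₁ = p ++ [false] ∧ fibMorph d₂ = q := by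
  induction d generalizing p with
  | nil => simp [fibMorph, blockSubst] at h
  | cons e d ih =>
    rcases p with _ | ⟨f, p⟩
    · cases e <;> simp [fibMorph_false_cons, fibMorph_true_cons] at h
    cases e
    · obtain ⟨rfl, htail⟩ : true = f ∧ fibMorph d = p ++ false :: q := by
        simpa [fibMorph_false_cons] using h
      obtain ⟨d₁, d₂, rfl, h₁, h₂⟩ := ih htail
      exact ⟨false :: d₁, d₂, rfl, by rw [fibMorph_false_cons, h₁, List.cons_append], h₂⟩
    · rcases p with _ | ⟨f', p⟩
      · obtain ⟨rfl, htail⟩ : true = f ∧ fibMorph d = q := by simpa [fibMorph_true_cons] using h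
        exact ⟨[true], d, rfl, rfl, htail⟩
      obtain ⟨rfl, rfl, htail⟩ : true = f ∧ false = f' ∧ fibMorph d = p ++ false :: q := by
        simpa [fibMorph_true_cons] using h
      obtain ⟨d₁, d₂, rfl, h₁, h₂⟩ := ih htail
      exact ⟨true :: d₁, d₂, rfl, by rw [fibMorph_true_cons, h₁]; rfl, h₂⟩

theorem exists_eq_fibMorph_of_isInfix {c d : List Bool}
    (h : true :: (c ++ [false]) <:+: fibMorph d) :
    ∃ c', c' <:+: d ∧ true :: (c ++ [false]) = fibMorph c' := by
  obtain ⟨p, q, h⟩ := h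
  obtain ⟨d₁, d₂, rfl, -, h₂⟩ :=
    fibMorph_eq_append_true_cons (d := d) (p := p) (q := c ++ false :: q) (by simp [← h])
  obtain ⟨c', d₃, rfl, h₁, -⟩ := fibMorph_eq_append_false_cons (p := true :: c) h₂
  exact ⟨c', ⟨d₁, d₃, by simp⟩, h₁.symm⟩

theorem exists_eq_fibMorphConj_of_isInfix {c d : List Bool}
    (h : false :: (c ++ [true]) <:+: fibMorphConj d) :
    ∃ c', c' <:+: d ∧ false :: (c ++ [true]) = fibMorphConj c' := by
  rw [fibMorphConj_eq_reverse, ← List.reverse_infix, List.reverse_reverse] at h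
  obtain ⟨c', hc', heq⟩ :=
    exists_eq_fibMorph_of_isInfix (c := c.reverse) (d := d.reverse) (by simpa using h)
  refine ⟨c'.reverse, by simpa using List.reverse_infix.2 hc', ?_⟩
  rw [fibMorphConj_eq_reverse, List.reverse_reverse, ← heq]
  simp

end FibonacciMorphism

section FibonacciWord

/-- The Fibonacci infinite word over the letters `a`, `b` that starts with `a`. -/
noncomputable def fibonacciWord (a b : A) : ℕ → A := (existsUnique_fibonacciWord a b).choose

theorem isPrefixOf_fibonacciWord (a b : A) {n : ℕ} (hn : 1 ≤ n) :
    IsPrefixOf (fibWord a b n) (fibonacciWord a b) :=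
  (existsUnique_fibonacciWord a b).choose_spec.1 n hn

theorem isFibonacciWord_iff {f : ℕ → A} :
    IsFibonacciWord f ↔ ∃ a b, a ≠ b ∧ f = fibonacciWord a b := by
  refine exists₂_congr fun a b => and_congr_right fun _ => ⟨fun h => ?_, ?_⟩
  · exact (existsUnique_fibonacciWord a b).unique h fun n => isPrefixOf_fibonacciWord a b
  · rintro rfl n
    exact isPrefixOf_fibonacciWord a b

theorem fibWord_isSuffix_add_two (a b : A) (n : ℕ) : fibWord a b n <:+ fibWord a b (n + 2) :=
  List.suffix_append _ _

theorem mem_factors_fibonacciWord {a b : A} {w : List A} :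
    w ∈ factors (fibonacciWord a b) ↔ ∃ n, w <:+: fibWord a b n := by
  constructor
  · rintro ⟨i, hi⟩
    have hlen := (le_length_fibWord a b (i + w.length + 1)).1
    exact ⟨i + w.length + 1, hi.isInfix (isPrefixOf_fibonacciWord a b (by omega)) i.zero_le
      (by omega)⟩
  · rintro ⟨n, hn⟩
    exact mem_factors_of_isInfix (hn.trans (fibWord_isSuffix_add_two a b n).isInfix)
      ⟨0, isPrefixOf_fibonacciWord a b (by omega)⟩

theorem fibWord_add (a b : A) (n k : ℕ) :
    fibWord a b (n + k) =
      blockSubst (fibWord a b n) (fibWord a b (n + 1)) (fibWord true false k) := by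
  induction k using Nat.twoStepInduction with
  | zero => exact (blockSubst_singleton _ _ false).symm
  | one => exact (blockSubst_singleton _ _ true).symm
  | more k h₀ h₁ => rw [fibWord, blockSubst_append, ← h₀, ← h₁, ← Nat.add_assoc, fibWord]; rfl

theorem blockSubst_fibWord_mem_factors (a b : A) (n : ℕ) {c : List Bool}
    (hc : c ∈ factors (fibonacciWord true false)) :
    blockSubst (fibWord a b n) (fibWord a b (n + 1)) c ∈ factors (fibonacciWord a b) := by
  obtain ⟨k, hk⟩ := mem_factors_fibonacciWord.1 hc
  exact mem_factors_fibonacciWord.2 ⟨n + k, fibWord_add a b n k ▸ blockSubst_isInfix _ _ hk⟩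

theorem fibMorph_fibWord (n : ℕ) : fibMorph (fibWord true false n) = fibWord true false (n + 1) :=
  (Nat.add_comm 1 n ▸ fibWord_add true false 1 n).symm

theorem fibMorph_mem_factors {c : List Bool} (hc : c ∈ factors (fibonacciWord true false)) :
    fibMorph c ∈ factors (fibonacciWord true false) :=
  blockSubst_fibWord_mem_factors true false 1 hc

theorem fibMorphConj_mem_factors {c : List Bool} (hc : c ∈ factors (fibonacciWord true false)) :
    fibMorphConj c ∈ factors (fibonacciWord true false) := by
  obtain ⟨e, he⟩ := exists_append_mem_factors hc
  refine mem_factors_of_isInfix ?_ (fibMorph_mem_factors he)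
  refine (List.suffix_cons true _).isInfix.trans (List.IsPrefix.isInfix ?_)
  rw [true_cons_fibMorphConj, fibMorph_append, List.prefix_append_right_inj]
  cases e
  · exact ⟨[], rfl⟩
  · exact ⟨[false], rfl⟩

theorem exists_isInfix_fibMorph {c : List Bool} (hc : c ∈ factors (fibonacciWord true false)) :
    ∃ d ∈ factors (fibonacciWord true false), c <:+: fibMorph d := by
  obtain ⟨n, hn⟩ := mem_factors_fibonacciWord.1 hc
  refine ⟨fibWord true false (n + 1), mem_factors_fibonacciWord.2 ⟨n + 1, List.infix_rfl⟩, ?_⟩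
  rw [fibMorph_fibWord]
  exact hn.trans (fibWord_isSuffix_add_two true false n).isInfix

theorem exists_eq_fibMorph_of_mem_factors {c : List Bool}
    (hc : true :: (c ++ [false]) ∈ factors (fibonacciWord true false)) :
    ∃ c' ∈ factors (fibonacciWord true false), true :: (c ++ [false]) = fibMorph c' := by
  obtain ⟨d, hd, hcd⟩ := exists_isInfix_fibMorph hc
  obtain ⟨c', hc', heq⟩ := exists_eq_fibMorph_of_isInfix hcd
  exact ⟨c', mem_factors_of_isInfix hc' hd, heq⟩

theorem exists_eq_fibMorphConj_of_mem_factors {c : List Bool}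
    (hc : false :: (c ++ [true]) ∈ factors (fibonacciWord true false)) :
    ∃ c' ∈ factors (fibonacciWord true false), false :: (c ++ [true]) = fibMorphConj c' := by
  obtain ⟨d, hd, hcd⟩ := exists_isInfix_fibMorph hc
  have hcd' : false :: (c ++ [true]) <:+: true :: fibMorphConj d :=
    true_cons_fibMorphConj d ▸ hcd.trans (List.prefix_append _ _).isInfix
  rw [List.infix_cons_iff, List.cons_prefix_cons] at hcd'
  obtain ⟨c', hc', heq⟩ :=
    exists_eq_fibMorphConj_of_isInfix (hcd'.resolve_left fun h => Bool.false_ne_true h.1)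
  exact ⟨c', mem_factors_of_isInfix hc' hd, heq⟩

theorem fibMorph_pair_mem_factors (e e' : Bool) :
    fibMorph [e, e'] ∈ factors (fibonacciWord true false) :=
  mem_factors_fibonacciWord.2 ⟨7, by cases e <;> cases e' <;> decide⟩

theorem fibMorphConj_pair_mem_factors (e e' : Bool) :
    fibMorphConj [e, e'] ∈ factors (fibonacciWord true false) :=
  mem_factors_fibonacciWord.2 ⟨7, by cases e <;> cases e' <;> decide⟩

end FibonacciWord

section LyndonSequence

variable [LinearOrder A]

theorem blockSubst_sortedAppend_of_lt {u v : List A} (h : u < v) (c : List Bool) :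
    blockSubst v (sortedAppend u v) c = blockSubst u v (fibMorphConj c) := by
  rw [fibMorphConj, blockSubst_blockSubst, blockSubst_singleton, blockSubst_pair,
    sortedAppend_of_lt h]
  rfl

theorem blockSubst_sortedAppend_of_gt {u v : List A} (h : v < u) (c : List Bool) :
    blockSubst v (sortedAppend u v) c = blockSubst u v (fibMorph c) := by
  rw [fibMorph, blockSubst_blockSubst, blockSubst_singleton, blockSubst_pair,
    sortedAppend_of_gt h]
  rfl

theorem IsLyndon.block_lt_block {u v : List A} (hu : u ≠ []) (hv : v ≠ []) {e e' : Bool}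
    {c : List Bool} (h : IsLyndon (blockSubst u v (e :: (c ++ [e'])))) :
    block u v e < block u v e' := by
  rw [blockSubst_cons, blockSubst_append, blockSubst_singleton, ← List.append_assoc] at h
  exact h.left_lt_right (block_ne_nil hu hv e) (block_ne_nil hu hv e')

/-- A Lyndon word begins with the smaller of the two blocks and ends with the larger one, so that
its code is the image of a Fibonacci factor under `fibMorph` or `fibMorphConj`. -/
theorem IsLyndon.eq_or_exists_eq_blockSubst_sortedAppend {u v : List A} (hu : u ≠ [])
    (hv : v ≠ []) {c : List Bool} (hc : c ∈ factors (fibonacciWord true false))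
    (hw : IsLyndon (blockSubst u v c)) :
    (∃ e, blockSubst u v c = block u v e) ∨ ∃ c' ∈ factors (fibonacciWord true false),
      blockSubst u v c = blockSubst v (sortedAppend u v) c' := by
  rcases c with _ | ⟨e, c⟩
  · exact absurd rfl hw.1
  rcases List.eq_nil_or_concat' c with rfl | ⟨c, e', rfl⟩
  · exact Or.inl ⟨e, blockSubst_singleton u v e⟩
  right
  have hlt := hw.block_lt_block hu hv
  rcases e with _ | _ <;> rcases e' with _ | _
  · exact absurd hlt (lt_irrefl u)
  · obtain ⟨c', hc', heq⟩ := exists_eq_fibMorphConj_of_mem_factors hc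
    exact ⟨c', hc', by rw [heq, blockSubst_sortedAppend_of_lt (u := u) (v := v) hlt]⟩
  · obtain ⟨c', hc', heq⟩ := exists_eq_fibMorph_of_mem_factors hc
    exact ⟨c', hc', by rw [heq, blockSubst_sortedAppend_of_gt (u := u) (v := v) hlt]⟩
  · exact absurd hlt (lt_irrefl v)

/-- The Lyndon factors of `fibonacciWord a b`, by nondecreasing length. -/
def lyndonSeq (a b : A) : ℕ → List A
  | 0 => [b]
  | 1 => [a]
  | n + 2 => sortedAppend (lyndonSeq a b n) (lyndonSeq a b (n + 1))

theorem length_lyndonSeq (a b : A) (n : ℕ) : (lyndonSeq a b n).length = Nat.fib (n + 1) := by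
  induction n using Nat.twoStepInduction with
  | zero => rfl
  | one => rfl
  | more n h₀ h₁ => rw [lyndonSeq, length_sortedAppend, h₀, h₁, Nat.fib_add_two (n := n + 1)]

theorem lyndonSeq_ne_nil (a b : A) (n : ℕ) : lyndonSeq a b n ≠ [] :=
  List.ne_nil_of_length_pos (length_lyndonSeq a b n ▸ Nat.fib_pos.2 n.succ_pos)

theorem lyndonSeq_injective {a b : A} (hab : a ≠ b) : Function.Injective (lyndonSeq a b) := by
  have hlen : ∀ m n, lyndonSeq a b (m + 1) = lyndonSeq a b (n + 1) → m = n := fun m n h => by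
    have := congrArg List.length h
    rw [length_lyndonSeq, length_lyndonSeq] at this
    exact Nat.fib_add_two_strictMono.injective this
  have hzero : ∀ n, lyndonSeq a b 0 ≠ lyndonSeq a b (n + 1) := fun n h => by
    have hfib := congrArg List.length h
    rw [length_lyndonSeq, length_lyndonSeq] at hfib
    obtain rfl : 0 = n := Nat.fib_add_two_strictMono.injective hfib
    exact hab (List.singleton_injective h).symm
  rintro (_ | m) (_ | n) h
  · rfl
  · exact absurd h (hzero n)
  · exact absurd h.symm (hzero m)
  · rw [hlen m n h]

theorem lyndonSeq_ne_succ {a b : A} (hab : a ≠ b) (n : ℕ) :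
    lyndonSeq a b n ≠ lyndonSeq a b (n + 1) :=
  (lyndonSeq_injective hab).ne n.succ_ne_self.symm

theorem isLyndon_lyndonSeq {a b : A} (hab : a ≠ b) (n : ℕ) : IsLyndon (lyndonSeq a b n) := by
  induction n using Nat.twoStepInduction with
  | zero => exact isLyndon_singleton b
  | one => exact isLyndon_singleton a
  | more n h₀ h₁ => exact isLyndon_sortedAppend h₀ h₁ (lyndonSeq_ne_succ hab n)

theorem blockSubst_lyndonSeq_mem_factors {a b : A} (hab : a ≠ b) (n : ℕ) {c : List Bool}
    (hc : c ∈ factors (fibonacciWord true false)) :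
    blockSubst (lyndonSeq a b n) (lyndonSeq a b (n + 1)) c ∈ factors (fibonacciWord a b) := by
  induction n generalizing c with
  | zero => exact blockSubst_fibWord_mem_factors a b 0 hc
  | succ n ih =>
    rw [lyndonSeq]
    rcases (lyndonSeq_ne_succ hab n).lt_or_gt with h | h
    · rw [blockSubst_sortedAppend_of_lt h]
      exact ih (fibMorphConj_mem_factors hc)
    · rw [blockSubst_sortedAppend_of_gt h]
      exact ih (fibMorph_mem_factors hc)

theorem fib_le_length_blockSubst_lyndonSeq (a b : A) (n : ℕ) {c : List Bool} (hc : c ≠ []) :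
    Nat.fib (n + 1) ≤ (blockSubst (lyndonSeq a b n) (lyndonSeq a b (n + 1)) c).length := by
  obtain ⟨e, c, rfl⟩ := List.exists_cons_of_ne_nil hc
  rw [blockSubst_cons, List.length_append]
  refine le_add_right ?_
  cases e
  · exact (length_lyndonSeq a b n).ge
  · exact Nat.fib_le_fib_succ.trans (length_lyndonSeq a b (n + 1)).ge

theorem IsLyndon.mem_range_lyndonSeq_or_exists_eq_blockSubst {a b : A} {w : List A}
    (hw : IsLyndon w) (hwf : w ∈ factors (fibonacciWord a b)) (n : ℕ) :
    w ∈ Set.range (lyndonSeq a b) ∨ ∃ c ∈ factors (fibonacciWord true false),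
      w = blockSubst (lyndonSeq a b n) (lyndonSeq a b (n + 1)) c := by
  induction n with
  | zero =>
    obtain ⟨m, hm⟩ := mem_factors_fibonacciWord.1 hwf
    rw [← Nat.zero_add m, fibWord_add] at hm
    obtain ⟨c, hc, rfl⟩ := exists_eq_blockSubst_singleton hm
    exact Or.inr ⟨c, mem_factors_fibonacciWord.2 ⟨m, hc⟩, rfl⟩
  | succ n ih =>
    rcases ih with ih | ⟨c, hc, rfl⟩
    · exact Or.inl ih
    refine (hw.eq_or_exists_eq_blockSubst_sortedAppend (lyndonSeq_ne_nil a b n)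
      (lyndonSeq_ne_nil a b (n + 1)) hc).imp_left ?_
    rintro ⟨_ | _, he⟩
    · exact ⟨n, he.symm⟩
    · exact ⟨n + 1, he.symm⟩

theorem isLyndon_and_mem_factors_fibonacciWord_iff {a b : A} (hab : a ≠ b) {w : List A} :
    w ∈ factors (fibonacciWord a b) ∧ IsLyndon w ↔ w ∈ Set.range (lyndonSeq a b) := by
  constructor
  · rintro ⟨hwf, hw⟩
    refine (hw.mem_range_lyndonSeq_or_exists_eq_blockSubst hwf (w.length + 1)).resolve_right ?_
    rintro ⟨c, -, heq⟩
    have hc : c ≠ [] := by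
      rintro rfl
      exact hw.1 heq
    have hle := fib_le_length_blockSubst_lyndonSeq a b (w.length + 1) hc
    have := Nat.le_fib_add_one (w.length + 1 + 1)
    rw [← heq] at hle
    omega
  · rintro ⟨n, rfl⟩
    refine ⟨?_, isLyndon_lyndonSeq hab n⟩
    rw [← show blockSubst (lyndonSeq a b n) (lyndonSeq a b (n + 1)) [false] = lyndonSeq a b n from
      blockSubst_singleton _ _ _]
    exact blockSubst_lyndonSeq_mem_factors hab n
      (mem_factors_fibonacciWord.2 ⟨0, List.infix_rfl⟩)

theorem lyndonFactors_fibonacciWord {a b : A} (hab : a ≠ b) (n : ℕ) :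
    lyndonFactors (fibonacciWord a b) n = lyndonSeq a b '' Set.Iio (Nat.greatestFib n) := by
  have hmem : ∀ k, k ∈ Set.Iio (Nat.greatestFib n) ↔ (lyndonSeq a b k).length ≤ n := fun k => by
    rw [Set.mem_Iio, ← Nat.succ_le_iff, Nat.le_greatestFib, length_lyndonSeq]
  ext w
  rw [lyndonFactors, Set.mem_ofPred_eq, ← and_assoc,
    isLyndon_and_mem_factors_fibonacciWord_iff hab]
  constructor
  · rintro ⟨⟨k, rfl⟩, hk⟩
    exact ⟨k, (hmem k).2 hk, rfl⟩
  · rintro ⟨k, hk, rfl⟩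
    exact ⟨⟨k, rfl⟩, (hmem k).1 hk⟩

theorem lyndonCount_fibonacciWord {a b : A} (hab : a ≠ b) (n : ℕ) :
    lyndonCount (fibonacciWord a b) n = Nat.greatestFib n := by
  rw [← ncard_lyndonFactors, lyndonFactors_fibonacciWord hab,
    Set.ncard_image_of_injective _ (lyndonSeq_injective hab), Set.ncard_Iio_nat]

end LyndonSequence

section Tilings

variable {x : ℕ → A} {u v : List A} {m : ℕ}

/-- The tail of `x` from position `m` on is an infinite product of the blocks `u` and `v`. The
product is encoded by a set of cut points, each of which starts a block that leads to another. -/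
def TiledFrom (x : ℕ → A) (u v : List A) (m : ℕ) : Prop :=
  ∃ I : Set ℕ, m ∈ I ∧ ∀ i ∈ I, ∃ e, OccursAt x (block u v e) i ∧ i + (block u v e).length ∈ I

theorem TiledFrom.symm (h : TiledFrom x u v m) : TiledFrom x v u m := by
  obtain ⟨I, hm, hI⟩ := h
  refine ⟨I, hm, fun i hi => ?_⟩
  obtain ⟨e, he⟩ := hI i hi
  exact ⟨!e, by cases e <;> exact he⟩

theorem TiledFrom.exists_occursAt_pair (h : TiledFrom x u v m) (hu : u ≠ []) (hv : v ≠ [])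
    {p : ℕ} (hp : m ≤ p) : ∃ e e' i, OccursAt x (block u v e ++ block u v e') i ∧ i ≤ p ∧
      p < i + (block u v e).length := by
  obtain ⟨I, hm, hI⟩ := h
  obtain ⟨i, ⟨hi, hip⟩, hmax⟩ := Set.exists_max_image (I ∩ Set.Iic p) id
    ((Set.finite_Iic p).inter_of_right I) ⟨m, hm, hp⟩
  obtain ⟨e, he, hnext⟩ := hI i hi
  obtain ⟨e', he', -⟩ := hI _ hnext
  refine ⟨e, e', i, occursAt_append.2 ⟨he, he'⟩, hip, ?_⟩
  by_contra! hle
  have hlast : i + (block u v e).length ≤ i := hmax _ ⟨hnext, hle⟩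
  have := List.length_pos_of_ne_nil (block_ne_nil hu hv e)
  omega

theorem TiledFrom.append_of_left_isolated (h : TiledFrom x u v m) (hx : Aperiodic x)
    (hu : u ≠ []) (huuv : u ++ (u ++ v) ∉ factors x) : TiledFrom x v (u ++ v) m := by
  obtain ⟨I, hm, hI⟩ := h
  let J : Set ℕ := {i | OccursAt x (u ++ u) i ∧ i + u.length + u.length ∈ I}
  have hJ : ¬ J.Nonempty := fun hne => hx <| ultimatelyPeriodic_of_occursAt hu hne fun i hi => by
    obtain ⟨h₁, h₂⟩ := occursAt_append.1 hi.1
    refine ⟨h₁, ?_⟩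
    obtain ⟨_ | _, h₃, hnext⟩ := hI _ hi.2
    · exact ⟨occursAt_append.2 ⟨h₂, h₃⟩, hnext⟩
    · exact absurd ⟨i, occursAt_append.2 ⟨h₁, occursAt_append.2 ⟨h₂, h₃⟩⟩⟩ huuv
  refine ⟨I, hm, fun i hi => ?_⟩
  obtain ⟨_ | _, h₁, hi₁⟩ := hI i hi
  · obtain ⟨_ | _, h₂, hi₂⟩ := hI _ hi₁
    · exact absurd ⟨i, occursAt_append.2 ⟨h₁, h₂⟩, hi₂⟩ hJ
    · refine ⟨true, occursAt_append.2 ⟨h₁, h₂⟩, ?_⟩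
      rwa [Nat.add_assoc, ← List.length_append] at hi₂
  · exact ⟨false, h₁, hi₁⟩

theorem TiledFrom.append_of_right_isolated (h : TiledFrom x u v m) (hx : Aperiodic x)
    (hv : v ≠ []) (huvv : u ++ v ++ v ∉ factors x) : ∃ m', TiledFrom x u (u ++ v) m' := by
  obtain ⟨I, hm, hI⟩ := h
  let I' : Set ℕ := {i | OccursAt x u i ∧ i + u.length ∈ I}
  obtain ⟨m', hm'⟩ : I'.Nonempty := by
    by_contra hne
    refine hx (ultimatelyPeriodic_of_occursAt hv ⟨m, hm⟩ fun i hi => ?_)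
    obtain ⟨_ | _, h₁⟩ := hI i hi
    · exact absurd ⟨i, h₁⟩ hne
    · exact h₁
  refine ⟨m', I', hm', fun i ⟨h₁, hi₁⟩ => ?_⟩
  obtain ⟨_ | _, h₂, hi₂⟩ := hI _ hi₁
  · exact ⟨false, h₁, h₂, hi₂⟩
  · have huv : OccursAt x (u ++ v) i := occursAt_append.2 ⟨h₁, h₂⟩
    have hlen : i + (u ++ v).length = i + u.length + v.length := by
      rw [List.length_append, Nat.add_assoc]
    obtain ⟨_ | _, h₃, hi₃⟩ := hI _ hi₂
    · exact ⟨true, huv, (hlen ▸ ⟨h₃, hi₃⟩ : i + (u ++ v).length ∈ I')⟩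
    · exact absurd ⟨i, occursAt_append.2 ⟨huv, hlen ▸ h₃⟩⟩ huvv

theorem TiledFrom.exists_sortedAppend [LinearOrder A] (h : TiledFrom x u v m) (hx : Aperiodic x)
    (hu : IsLyndon u) (hv : v ≠ []) (huv : u ≠ v)
    (hsq : sortedAppend u (sortedAppend u v) ∉ factors x) :
    ∃ m', TiledFrom x v (sortedAppend u v) m' := by
  rcases huv.lt_or_gt with hlt | hlt
  · rw [sortedAppend_of_lt hlt, sortedAppend_of_lt (lt_append_of_ne_nil u hv)] at hsq
    exact ⟨m, sortedAppend_of_lt hlt ▸ h.append_of_left_isolated hx hu.1 hsq⟩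
  · rw [sortedAppend_of_gt hlt, sortedAppend_of_gt (hu.append_lt_right hv hlt)] at hsq
    exact sortedAppend_of_gt hlt ▸ h.symm.append_of_right_isolated hx hu.1 hsq

theorem exists_tiledFrom_lyndonSeq [LinearOrder A] {a b : A} (hab : a ≠ b) (hx : Aperiodic x)
    (hletter : ∀ i, x i = a ∨ x i = b)
    (hsq : ∀ n, sortedAppend (lyndonSeq a b n) (lyndonSeq a b (n + 2)) ∉ factors x) (n : ℕ) :
    ∃ m, TiledFrom x (lyndonSeq a b n) (lyndonSeq a b (n + 1)) m := by
  induction n with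
  | zero =>
    refine ⟨0, Set.univ, trivial, fun i _ => ?_⟩
    rcases hletter i with h | h
    · exact ⟨true, occursAt_singleton.2 h.symm, trivial⟩
    · exact ⟨false, occursAt_singleton.2 h.symm, trivial⟩
  | succ n ih =>
    obtain ⟨m, hm⟩ := ih
    exact hm.exists_sortedAppend hx (isLyndon_lyndonSeq hab n) (lyndonSeq_ne_nil a b (n + 1))
      (lyndonSeq_ne_succ hab n) (hsq n)

end Tilings

section OrbitClosure

variable {x : ℕ → A}

theorem block_lyndonSeq_append_mem_factors [LinearOrder A] {a b : A} (hab : a ≠ b) (n : ℕ)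
    (e e' : Bool) :
    block (lyndonSeq a b (n + 1)) (lyndonSeq a b (n + 2)) e ++
      block (lyndonSeq a b (n + 1)) (lyndonSeq a b (n + 2)) e' ∈ factors (fibonacciWord a b) := by
  rw [← blockSubst_pair, lyndonSeq]
  rcases (lyndonSeq_ne_succ hab n).lt_or_gt with h | h
  · rw [blockSubst_sortedAppend_of_lt h]
    exact blockSubst_lyndonSeq_mem_factors hab n (fibMorphConj_pair_mem_factors e e')
  · rw [blockSubst_sortedAppend_of_gt h]
    exact blockSubst_lyndonSeq_mem_factors hab n (fibMorph_pair_mem_factors e e')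

theorem Recurrent.mem_shiftOrbitClosure_of_tiledFrom [LinearOrder A] {a b : A} (hab : a ≠ b)
    (hx : Recurrent x)
    (h : ∀ n, ∃ m, TiledFrom x (lyndonSeq a b n) (lyndonSeq a b (n + 1)) m) :
    x ∈ shiftOrbitClosure (fibonacciWord a b) := by
  intro w hw
  obtain ⟨m, hm⟩ := h (w.length + 1)
  obtain ⟨p, hmp, hp⟩ := hx.exists_occursAt_ge hw m
  obtain ⟨e, e', i, hi, hip, hpi⟩ :=
    hm.exists_occursAt_pair (lyndonSeq_ne_nil a b _) (lyndonSeq_ne_nil a b _) hmp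
  refine mem_factors_of_isInfix (hp.isInfix hi hip ?_)
    (block_lyndonSeq_append_mem_factors hab w.length e e')
  have hlong := fib_le_length_blockSubst_lyndonSeq a b (w.length + 1) (List.cons_ne_nil e' [])
  have := Nat.le_fib_add_one (w.length + 1 + 1)
  rw [blockSubst_singleton] at hlong
  rw [List.length_append]
  omega

theorem isPrefixOf_blockSubst_fibonacciWord (a b : A) (n : ℕ) {c : List Bool}
    (hc : IsPrefixOf c (fibonacciWord true false)) :
    IsPrefixOf (blockSubst (fibWord a b n) (fibWord a b (n + 1)) c) (fibonacciWord a b) := by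
  obtain ⟨d, hd⟩ : c <+: fibWord true false (c.length + 1) :=
    hc.isPrefix (isPrefixOf_fibonacciWord true false (Nat.le_add_left 1 _))
      (by have := (le_length_fibWord true false (c.length + 1)).1; omega)
  have hpre := isPrefixOf_fibonacciWord a b (n := n + (c.length + 1)) (by omega)
  rw [fibWord_add, ← hd, blockSubst_append] at hpre
  exact (occursAt_append.1 hpre).1

theorem tiledFrom_fibonacciWord (a b : A) (n : ℕ) :
    TiledFrom (fibonacciWord a b) (fibWord a b n) (fibWord a b (n + 1)) 0 := by
  let φ := blockSubst (fibWord a b n) (fibWord a b (n + 1))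
  refine ⟨{i | ∃ c, IsPrefixOf c (fibonacciWord true false) ∧ (φ c).length = i},
    ⟨[], fun j hj => absurd hj j.not_lt_zero, rfl⟩, ?_⟩
  rintro _ ⟨c, hc, rfl⟩
  have hnext : IsPrefixOf (c ++ [fibonacciWord true false c.length]) (fibonacciWord true false) :=
    occursAt_append.2 ⟨hc, occursAt_singleton.2 (by rw [Nat.zero_add])⟩
  have himage := isPrefixOf_blockSubst_fibonacciWord a b n hnext
  rw [blockSubst_append, blockSubst_singleton, IsPrefixOf, occursAt_append, Nat.zero_add] at himage
  refine ⟨_, himage.2, _, hnext, ?_⟩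
  rw [← List.length_append, ← blockSubst_singleton, ← blockSubst_append]

theorem factors_eq_of_mem_shiftOrbitClosure {a b : A}
    (hx : x ∈ shiftOrbitClosure (fibonacciWord a b)) : factors x = factors (fibonacciWord a b) := by
  refine hx.antisymm fun w hw => ?_
  obtain ⟨n, hn, hpre⟩ : ∃ n, w <:+: fibWord a b n ∧ fibWord a b n <+: fibWord a b (n + 1) := by
    obtain ⟨n, hn⟩ := mem_factors_fibonacciWord.1 hw
    exact ⟨n + 2, hn.trans (fibWord_isSuffix_add_two a b n).isInfix, List.prefix_append _ _⟩
  have hblock : ∀ e, w <:+: block (fibWord a b n) (fibWord a b (n + 1)) e ∧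
      (block (fibWord a b n) (fibWord a b (n + 1)) e).length ≤ (fibWord a b (n + 1)).length := by
    rintro (_ | _)
    · exact ⟨hn, hpre.length_le⟩
    · exact ⟨hn.trans hpre.isInfix, le_rfl⟩
  set z := (List.range' 0 (2 * (fibWord a b (n + 1)).length)).map x with hz
  have hzx : z ∈ factors x := ⟨0, occursAt_map_range' x 0 _⟩
  obtain ⟨p, hp⟩ := hx hzx
  have hne : ∀ k, fibWord a b k ≠ [] := fun k =>
    List.ne_nil_of_length_pos (le_length_fibWord a b k).2
  obtain ⟨e, e', i, hi, hip, hpi⟩ :=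
    (tiledFrom_fibonacciWord a b n).exists_occursAt_pair (hne _) (hne _) p.zero_le
  refine mem_factors_of_isInfix ((hblock e').1.trans ?_) hzx
  refine (occursAt_append.1 hi).2.isInfix hp hpi.le ?_
  have := (hblock e).2
  have := (hblock e').2
  rw [hz, List.length_map, List.length_range']
  omega

theorem lyndonCount_of_mem_shiftOrbitClosure [LinearOrder A] {a b : A} (hab : a ≠ b)
    (hx : x ∈ shiftOrbitClosure (fibonacciWord a b)) (n : ℕ) :
    lyndonCount x n = Nat.greatestFib n := by
  rw [← lyndonCount_fibonacciWord hab, lyndonCount, factors_eq_of_mem_shiftOrbitClosure hx]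
  rfl

end OrbitClosure

section EqualityCase

variable [LinearOrder A] {x : ℕ → A}

theorem exists_letters_of_lyndonCount_one (h : lyndonCount x 1 = 2) :
    ∃ p q, p < q ∧ ∀ i, x i = p ∨ x i = q := by
  obtain ⟨u, v, huv, hS⟩ := Set.ncard_eq_two.1 h
  have hletter : ∀ w ∈ lyndonFactors x 1, ∃ c, w = [c] := fun w hw =>
    List.length_eq_one_iff.1 (hw.2.2.antisymm (List.length_pos_of_ne_nil hw.2.1.1))
  obtain ⟨p, rfl⟩ := hletter u (hS.ge (Set.mem_insert _ _))
  obtain ⟨q, rfl⟩ := hletter v (hS.ge (Set.mem_insert_of_mem _ rfl))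
  have hx : ∀ i, x i = p ∨ x i = q := fun i => by
    have : [x i] ∈ ({[p], [q]} : Set (List A)) :=
      hS.le ⟨⟨i, occursAt_singleton.2 rfl⟩, isLyndon_singleton _, le_rfl⟩
    simpa using this
  have hpq : p ≠ q := fun h => huv (by rw [h])
  rcases hpq.lt_or_gt with hlt | hlt
  · exact ⟨p, q, hlt, hx⟩
  · exact ⟨q, p, hlt, fun i => (hx i).symm⟩

variable [Finite A]

theorem lyndonCount_lt_of_isLyndon {w : List A} (hw : w ∈ factors x) (hlyn : IsLyndon w) {m : ℕ}
    (hm : m < w.length) : lyndonCount x m < lyndonCount x w.length :=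
  Set.ncard_lt_ncard ⟨lyndonFactors_mono x hm.le, fun h => hm.not_ge (h ⟨hw, hlyn, le_rfl⟩).2.2⟩
    (finite_lyndonFactors x _)

theorem notMem_factors_of_lyndonCount_eq_greatestFib (h : ∀ n, lyndonCount x n = Nat.greatestFib n)
    {w : List A} (hw : IsLyndon w) {k : ℕ} (hlo : Nat.fib k < w.length)
    (hhi : w.length < Nat.fib (k + 1)) : w ∉ factors x := by
  intro hmem
  have hlt := lyndonCount_lt_of_isLyndon hmem hw hlo
  rw [h, h] at hlt
  have hge : k ≤ Nat.greatestFib (Nat.fib k) := Nat.le_greatestFib.2 le_rfl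
  have hle : Nat.greatestFib w.length < k + 1 := Nat.greatestFib_lt.2 hhi
  omega

theorem sortedAppend_lyndonSeq_notMem_factors (h : ∀ n, lyndonCount x n = Nat.greatestFib n)
    {a b : A} (hab : a ≠ b) (n : ℕ) :
    sortedAppend (lyndonSeq a b (n + 1)) (lyndonSeq a b (n + 3)) ∉ factors x := by
  have hne : lyndonSeq a b (n + 1) ≠ lyndonSeq a b (n + 3) :=
    (lyndonSeq_injective hab).ne (by omega)
  have hlen : (sortedAppend (lyndonSeq a b (n + 1)) (lyndonSeq a b (n + 3))).length =
      Nat.fib (n + 2) + Nat.fib (n + 4) := by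
    rw [length_sortedAppend, length_lyndonSeq, length_lyndonSeq]
  have hpos : 0 < Nat.fib (n + 2) := Nat.fib_pos.2 (by omega)
  have hlt : Nat.fib (n + 2) < Nat.fib (n + 3) := Nat.fib_lt_fib_succ (by omega)
  have hrec : Nat.fib (n + 4 + 1) = Nat.fib (n + 3) + Nat.fib (n + 4) := Nat.fib_add_two
  exact notMem_factors_of_lyndonCount_eq_greatestFib h
    (isLyndon_sortedAppend (isLyndon_lyndonSeq hab _) (isLyndon_lyndonSeq hab _) hne)
    (k := n + 4) (by omega) (by omega)

theorem notMem_factors_or_notMem_factors (h : lyndonCount x 3 ≤ 4) {p q : A} (hpq : p < q) :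
    [p, p, q] ∉ factors x ∨ [p, q, q] ∉ factors x := by
  by_contra! hcon
  obtain ⟨hppq, hpqq⟩ := hcon
  have hp := isLyndon_singleton p
  have hq := isLyndon_singleton q
  have hlt : [p] < [q] := List.Lex.rel hpq
  have hpq' : IsLyndon [p, q] := hp.append hq hlt
  have hsub : ({[p], [q], [p, q], [p, p, q], [p, q, q]} : Set (List A)) ⊆ lyndonFactors x 3 := by
    rintro w (rfl | rfl | rfl | rfl | rfl)
    · exact ⟨mem_factors_of_isInfix ⟨[], [p, q], rfl⟩ hppq, hp, by simp⟩
    · exact ⟨mem_factors_of_isInfix ⟨[p, p], [], rfl⟩ hppq, hq, by simp⟩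
    · exact ⟨mem_factors_of_isInfix ⟨[p], [], rfl⟩ hppq, hpq', by simp⟩
    · exact ⟨hppq, hp.append hpq' (lt_append_of_ne_nil [p] (by simp)), by simp⟩
    · exact ⟨hpqq, hpq'.append hq (hq.append_lt_right (by simp) hlt), by simp⟩
  have hcard : ({[p], [q], [p, q], [p, p, q], [p, q, q]} : Set (List A)).ncard = 5 := by
    have hne := hpq.ne
    rw [Set.ncard_eq_toFinset_card']
    simp [Finset.card_insert_of_notMem, hne, hne.symm]
  have hle := Set.ncard_le_ncard hsub (finite_lyndonFactors x 3)
  rw [hcard, ncard_lyndonFactors] at hle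
  omega

theorem exists_letters_of_lyndonCount_eq_greatestFib
    (h : ∀ n, lyndonCount x n = Nat.greatestFib n) :
    ∃ a b, a ≠ b ∧ (∀ i, x i = a ∨ x i = b) ∧
      sortedAppend (lyndonSeq a b 0) (lyndonSeq a b 2) ∉ factors x := by
  obtain ⟨p, q, hpq, hx⟩ := exists_letters_of_lyndonCount_one ((h 1).trans (by decide))
  have hlt : [p] < [q] := List.Lex.rel hpq
  rcases notMem_factors_or_notMem_factors ((h 3).trans (by decide)).le hpq with habs | habs
  · refine ⟨q, p, hpq.ne', fun i => (hx i).symm, ?_⟩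
    change sortedAppend [p] (sortedAppend [p] [q]) ∉ factors x
    rwa [sortedAppend_of_lt hlt,
      sortedAppend_of_lt (lt_append_of_ne_nil [p] (by simp))]
  · refine ⟨p, q, hpq.ne, hx, ?_⟩
    change sortedAppend [q] (sortedAppend [q] [p]) ∉ factors x
    rwa [sortedAppend_of_gt hlt,
      sortedAppend_of_gt ((isLyndon_singleton q).append_lt_right (by simp) hlt)]

theorem Recurrent.exists_mem_shiftOrbitClosure (hx : Recurrent x) (hap : Aperiodic x)
    (h : ∀ n, lyndonCount x n = Nat.greatestFib n) :
    ∃ a b, a ≠ b ∧ x ∈ shiftOrbitClosure (fibonacciWord a b) := by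
  obtain ⟨a, b, hab, hletter, hsq⟩ := exists_letters_of_lyndonCount_eq_greatestFib h
  refine ⟨a, b, hab, hx.mem_shiftOrbitClosure_of_tiledFrom hab
    (exists_tiledFrom_lyndonSeq hab hap hletter ?_)⟩
  rintro (_ | n)
  · exact hsq
  · exact sortedAppend_lyndonSeq_notMem_factors h hab n

end EqualityCase

end LyndonFib

theorem theorem060720122147 {A : Type*} [LinearOrder A] [Finite A] [Nontrivial A]
    (x : ℕ → A) (hx : LyndonFib.Recurrent x)
    (f : ℕ → A) (hf : LyndonFib.IsFibonacciWord f) :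
    (LyndonFib.Aperiodic x ↔
      ∀ n, LyndonFib.lyndonCount f n ≤ LyndonFib.lyndonCount x n) ∧
    ((∀ n, LyndonFib.lyndonCount x n = LyndonFib.lyndonCount f n) ↔
      ∃ g : ℕ → A, LyndonFib.IsFibonacciWord g ∧ x ∈ LyndonFib.shiftOrbitClosure g) := by
  obtain ⟨a, b, hab, rfl⟩ := LyndonFib.isFibonacciWord_iff.1 hf
  simp only [LyndonFib.lyndonCount_fibonacciWord hab]
  refine ⟨⟨LyndonFib.Aperiodic.greatestFib_le_lyndonCount,
    hx.aperiodic_of_greatestFib_le_lyndonCount⟩, fun h => ?_, ?_⟩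
  · have hap := hx.aperiodic_of_greatestFib_le_lyndonCount fun n => (h n).ge
    obtain ⟨c, d, hcd, hxg⟩ := hx.exists_mem_shiftOrbitClosure hap h
    exact ⟨_, LyndonFib.isFibonacciWord_iff.2 ⟨c, d, hcd, rfl⟩, hxg⟩
  · rintro ⟨g, hg, hxg⟩ n
    obtain ⟨c, d, hcd, rfl⟩ := LyndonFib.isFibonacciWord_iff.1 hg
    exact LyndonFib.lyndonCount_of_mem_shiftOrbitClosure hcd hxg n
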